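/- There exist absolute constants $c, C > 0$ such that the following holds. Let $G=(V,E)$ be a finite simple undirected graph with $n$ vertices and $m$ edges that is almost $r$-regular, meaning that $r \le \deg(v) \le 2r$ for every vertex $v \in V$, where $r$ is a non-negative integer. Let $0<p<1$ be such that $p\,r \ge c\log n$. Let $G'=(V,E')$ be the random subgraph of $G$ obtained by selecting each edge of $G$ independently with probability $p$. Then the expected number of edges of $G$ that connect different connected components of $G'$ is at most $C\,(n^2/m)/p$. (If $m=0$, the expectation is $0$ and the bound is read as trivially true.) -/

import Mathlib

namespace SimpleGraph

/-- `G` is almost `r`-regular: every degree lies between `r` and `2r`. -/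
def IsAlmostRegular {V : Type*} (G : SimpleGraph V) [G.LocallyFinite] (r : ℕ) : Prop :=
  ∀ v : V, r ≤ G.degree v ∧ G.degree v ≤ 2 * r

/-- The edges of `G` that connect different connected components of `H`. -/
def interComponentEdges {V : Type*} (G H : SimpleGraph V) : Set (Sym2 V) :=
  {e | e ∈ G.edgeSet ∧
    ∃ u v : V, e = s(u, v) ∧ H.connectedComponentMk u ≠ H.connectedComponentMk v}

/-- The expected number of edges of `G` that connect different connected components of the random
subgraph of `G` obtained by selecting each edge of `G` independently with probability `p`. The
random edge set `S` has law `setBernoulli G.edgeSet p`: each edge of `G` belongs to `S`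
independently with probability `p`, and nothing else belongs to `S`. -/
noncomputable def expectedInterComponentEdges {V : Type*} (G : SimpleGraph V)
    (p : unitInterval) : ℝ :=
  ∫ S : Set (Sym2 V), ((G.interComponentEdges (SimpleGraph.fromEdgeSet S)).ncard : ℝ)
    ∂(ProbabilityTheory.setBernoulli G.edgeSet p)

end SimpleGraph

/-!
Write `n` and `m` for the numbers of vertices and edges of `G`. As `m ≤ n * r`, it is enough to
bound the expected number of edges between different components by `8 * (n / r) / p`.

The random subgraph of density `p` is the union of two independent ones, of densities `p / 2` and
`q = (p / 2) / (1 - p / 2) ≥ p / 2` (`Finset.bernoulliSum_bernoulliSum_union`).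

* After the first round only `4 * n / r` components are left in expectation
  (`SimpleGraph.bernoulliSum_card_connectedComponent_le`). At most `2 * n / r` components
  have more than `r / 2` vertices. A vertex set `S` with at most `r / 2` elements is left by at
  least `#S * r / 2` edges, because `G` is simple with minimum degree at least `r`; the
  probability that none of them is chosen is at most `exp (-#S * log n) = n ^ (-#S)`. Summing
  over all nonempty `S` gives at most `(1 + 1 / n) ^ n - 1 ≤ 2 ≤ 2 * n / r`.
* Given the first round, the sampling lemma of Karger, Klein and Tarjan
  (`SimpleGraph.mul_bernoulliSum_card_isSeparated_le`) bounds the expected number of edges which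
  are still separated after the second round by `1 / q ≤ 2 / p` times the number of components
  left by the first round.
-/

open Finset

/-! ### Expectations over random subsets of a finite set -/

namespace Finset

variable {α : Type*} [DecidableEq α]

/-- The expectation of `F T`, where `T` is the random subset of the finite set `E` which contains
each element of `E` independently with probability `p`. It is written as a finite sum, which makes
sense for every real `p`. -/
noncomputable def bernoulliSum (E : Finset α) (p : ℝ) (F : Finset α → ℝ) : ℝ :=
  ∑ T ∈ E.powerset, p ^ #T * (1 - p) ^ #(E \ T) * F T

variable {E : Finset α} {p q : ℝ} {F F' : Finset α → ℝ}

@[simp]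
lemma bernoulliSum_empty : bernoulliSum ∅ p F = F ∅ := by
  simp [bernoulliSum]

lemma bernoulliSum_insert {e : α} (he : e ∉ E) :
    bernoulliSum (insert e E) p F =
      p * bernoulliSum E p (fun T ↦ F (insert e T)) + (1 - p) * bernoulliSum E p F := by
  rw [bernoulliSum, sum_powerset_insert he, add_comm, bernoulliSum, bernoulliSum, mul_sum, mul_sum]
  congr 1
  · refine sum_congr rfl fun T hT ↦ ?_
    have heT : e ∉ T := fun h ↦ he (mem_powerset.1 hT h)
    rw [card_insert_of_notMem heT, insert_sdiff_insert, sdiff_insert_of_notMem he]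
    ring
  · refine sum_congr rfl fun T hT ↦ ?_
    have heT : e ∉ T := fun h ↦ he (mem_powerset.1 hT h)
    rw [insert_sdiff_of_notMem _ heT, card_insert_of_notMem (by simp [he])]
    ring

lemma bernoulliSum_mono (hp₀ : 0 ≤ p) (hp₁ : p ≤ 1) (h : ∀ T ⊆ E, F T ≤ F' T) :
    bernoulliSum E p F ≤ bernoulliSum E p F' := by
  have := sub_nonneg.2 hp₁
  exact sum_le_sum fun T hT ↦
    mul_le_mul_of_nonneg_left (h T (mem_powerset.1 hT)) (by positivity)

lemma bernoulliSum_congr (h : ∀ T ⊆ E, F T = F' T) :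
    bernoulliSum E p F = bernoulliSum E p F' :=
  sum_congr rfl fun T hT ↦ by rw [h T (mem_powerset.1 hT)]

lemma bernoulliSum_add :
    bernoulliSum E p (fun T ↦ F T + F' T) = bernoulliSum E p F + bernoulliSum E p F' := by
  simp [bernoulliSum, mul_add, sum_add_distrib]

lemma bernoulliSum_const_mul (c : ℝ) :
    bernoulliSum E p (fun T ↦ c * F T) = c * bernoulliSum E p F := by
  simp only [bernoulliSum, mul_sum]
  exact sum_congr rfl fun _ _ ↦ by ring

lemma bernoulliSum_sum {ι : Type*} (s : Finset ι) (F : ι → Finset α → ℝ) :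
    bernoulliSum E p (fun T ↦ ∑ i ∈ s, F i T) = ∑ i ∈ s, bernoulliSum E p (F i) := by
  simp only [bernoulliSum, mul_sum]
  exact sum_comm

lemma bernoulliSum_const (c : ℝ) : bernoulliSum E p (fun _ ↦ c) = c := by
  induction E using Finset.induction_on with
  | empty => simp
  | insert e E he ih => rw [bernoulliSum_insert he, ih]; ring

/-- The union of two independent random subsets, with densities `p` and `q`, is a random subset
with density `1 - (1 - p) * (1 - q)`. -/
lemma bernoulliSum_bernoulliSum_union (F : Finset α → ℝ) :
    bernoulliSum E p (fun T ↦ bernoulliSum E q fun U ↦ F (T ∪ U)) =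
      bernoulliSum E (p + q - p * q) F := by
  induction E using Finset.induction_on generalizing F with
  | empty => simp
  | insert e E he ih =>
    simp only [bernoulliSum_insert he, bernoulliSum_add, bernoulliSum_const_mul, insert_union,
      union_insert, insert_idem, ih fun T ↦ F (insert e T), ih F]
    ring

/-- The probability that the random subset of `E` avoids `B`. -/
lemma bernoulliSum_disjoint (B : Finset α) :
    bernoulliSum E p (fun T ↦ if Disjoint T B then 1 else 0) = (1 - p) ^ #(E ∩ B) := by
  induction E using Finset.induction_on with
  | empty => simp
  | insert e E he ih =>
    rw [bernoulliSum_insert he, ih]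
    by_cases heB : e ∈ B
    · simp only [disjoint_insert_left, heB, not_true_eq_false, false_and, if_false]
      rw [bernoulliSum_const, insert_inter_of_mem heB, card_insert_of_notMem (by simp [he])]
      ring
    · simp only [disjoint_insert_left, heB, not_false_eq_true, true_and]
      rw [ih, insert_inter_of_notMem heB]
      ring

end Finset

open MeasureTheory ProbabilityTheory in
/-- On a finite type, integration against `setBernoulli` is the finite sum `bernoulliSum`. -/
lemma ProbabilityTheory.integral_setBernoulli_coe_finset {α : Type*} [Finite α] [DecidableEq α]
    (E : Finset α) (p : unitInterval) (f : Set α → ℝ) :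
    ∫ S, f S ∂(setBernoulli (E : Set α) p) = E.bernoulliSum p (fun T ↦ f T) := by
  classical
  have := Fintype.ofFinite α
  rw [integral_fintype .of_finite, bernoulliSum]
  symm
  refine sum_of_injOn (fun T : Finset α ↦ (T : Set α)) (coe_injective.injOn) (by simp) ?_ ?_
  · intro S _ hS
    have hSE : ¬ S ⊆ (E : Set α) := by
      intro h
      refine hS ⟨S.toFinset, ?_, by simp⟩
      simpa [Finset.subset_iff, Set.subset_def] using h
    simp [measureReal_def, setBernoulli_singleton_of_not_subset p hSE]
  · intro T hT
    rw [setBernoulli_real_singleton p (by simpa using hT) E.finite_toSet, ← coe_sdiff,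
      Set.ncard_coe_finset, Set.ncard_coe_finset, smul_eq_mul]

/-! ### Edges between different components -/

namespace SimpleGraph

variable {V : Type*}

/-- The ends of `e` lie in different connected components of `H`. -/
def IsSeparated (H : SimpleGraph V) (e : Sym2 V) : Prop :=
  ∃ u v : V, e = s(u, v) ∧ H.connectedComponentMk u ≠ H.connectedComponentMk v

lemma isSeparated_mk {H : SimpleGraph V} {u v : V} :
    H.IsSeparated s(u, v) ↔ ¬ H.Reachable u v := by
  constructor
  · rintro ⟨a, b, hab, h⟩
    rw [ne_eq, ConnectedComponent.eq] at h
    obtain ⟨rfl, rfl⟩ | ⟨rfl, rfl⟩ := Sym2.eq_iff.1 hab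
    · exact h
    · exact fun h' ↦ h h'.symm
  · exact fun h ↦ ⟨u, v, rfl, fun h' ↦ h (ConnectedComponent.exact h')⟩

lemma IsSeparated.anti {H H' : SimpleGraph V} (hle : H ≤ H') {e : Sym2 V}
    (h : H'.IsSeparated e) : H.IsSeparated e := by
  induction e with | _ u v
  rw [isSeparated_mk] at h ⊢
  exact fun h' ↦ h (h'.mono hle)

lemma not_isSeparated_of_mem {S : Set (Sym2 V)} {e : Sym2 V} (he : e ∈ S) :
    ¬ (fromEdgeSet S).IsSeparated e := by
  induction e with | _ u v
  rw [isSeparated_mk, not_not]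
  by_cases huv : u = v
  · rw [huv]
  · exact Adj.reachable ((fromEdgeSet_adj S).2 ⟨he, huv⟩)

/-- Adding an edge between two components lowers the number of components. -/
lemma card_connectedComponent_insert_lt [Finite V] {S : Set (Sym2 V)} {e : Sym2 V}
    (he : (fromEdgeSet S).IsSeparated e) :
    Nat.card (fromEdgeSet (insert e S)).ConnectedComponent <
      Nat.card (fromEdgeSet S).ConnectedComponent := by
  obtain ⟨u, v, rfl, huv⟩ := he
  have hle : fromEdgeSet S ≤ fromEdgeSet (insert s(u, v) S) :=
    fromEdgeSet_mono (Set.subset_insert _ _)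
  have hsurj := ConnectedComponent.surjective_map_ofLE hle
  refine lt_of_le_of_ne (Nat.card_le_card_of_surjective _ hsurj) fun heq ↦ huv ?_
  have hinj := ((Nat.bijective_iff_surjective_and_card _).2 ⟨hsurj, heq.symm⟩).injective
  refine hinj (ConnectedComponent.sound ?_)
  have := not_isSeparated_of_mem (Set.mem_insert s(u, v) S)
  rwa [isSeparated_mk, not_not] at this

open Classical in
/-- **Sampling lemma of Karger, Klein and Tarjan.** Start from the edges in `S` and reveal the
edges of `E` one at a time. Every revealed edge that joins two current components is added with
probability `p`, and then merges these components, so in expectation there are at most `1 / p` such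
edges per component; the edges which are separated at the end are among them. -/
lemma mul_bernoulliSum_card_isSeparated_le [Finite V] {p : ℝ} (hp₀ : 0 ≤ p)
    (hp₁ : p ≤ 1) (E S : Finset (Sym2 V)) :
    p * E.bernoulliSum p (fun T ↦
        (#{e ∈ E | (fromEdgeSet ((S ∪ T : Finset (Sym2 V)) : Set (Sym2 V))).IsSeparated e} : ℝ)) ≤
      Nat.card (fromEdgeSet (S : Set (Sym2 V))).ConnectedComponent := by
  induction E using Finset.induction_on generalizing S with
  | empty => simp
  | insert e E he ih =>
    rw [bernoulliSum_insert he]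
    have hp₁' := sub_nonneg.2 hp₁
    by_cases hsep : (fromEdgeSet (S : Set (Sym2 V))).IsSeparated e
    · have hA : E.bernoulliSum p (fun T ↦ (#{f ∈ insert e E | (fromEdgeSet
            ((S ∪ insert e T : Finset (Sym2 V)) : Set (Sym2 V))).IsSeparated f} : ℝ)) ≤
          E.bernoulliSum p (fun T ↦ (#{f ∈ E | (fromEdgeSet
            ((insert e S ∪ T : Finset (Sym2 V)) : Set (Sym2 V))).IsSeparated f} : ℝ)) := by
        refine bernoulliSum_mono hp₀ hp₁ fun T _ ↦ ?_
        rw [union_insert, ← insert_union, filter_insert, if_neg]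
        exact not_isSeparated_of_mem (by simp)
      have hB : E.bernoulliSum p (fun T ↦ (#{f ∈ insert e E | (fromEdgeSet
            ((S ∪ T : Finset (Sym2 V)) : Set (Sym2 V))).IsSeparated f} : ℝ)) ≤
          1 + E.bernoulliSum p (fun T ↦ (#{f ∈ E | (fromEdgeSet
            ((S ∪ T : Finset (Sym2 V)) : Set (Sym2 V))).IsSeparated f} : ℝ)) := by
        conv_rhs => rw [← bernoulliSum_const (E := E) (p := p) 1, ← bernoulliSum_add]
        refine bernoulliSum_mono hp₀ hp₁ fun T _ ↦ ?_
        rw [filter_insert]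
        split_ifs
        · exact_mod_cast (card_insert_le _ _).trans_eq (add_comm _ _)
        · simp
      have hcard : (Nat.card (fromEdgeSet ((insert e S : Finset (Sym2 V)) :
          Set (Sym2 V))).ConnectedComponent : ℝ) + 1 ≤
            Nat.card (fromEdgeSet (S : Set (Sym2 V))).ConnectedComponent := by
        rw [coe_insert]
        exact_mod_cast card_connectedComponent_insert_lt hsep
      have hA' := (mul_le_mul_of_nonneg_left hA hp₀).trans (ih (insert e S))
      have hB' := (mul_le_mul_of_nonneg_left hB hp₀).trans
        ((mul_add _ _ _).trans_le (add_le_add_right (ih S) _))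
      rw [mul_add, mul_left_comm p (1 - p)]
      nlinarith [mul_le_mul_of_nonneg_left (hA'.trans (le_sub_iff_add_le.2 hcard)) hp₀,
        mul_le_mul_of_nonneg_left hB' hp₁', mul_nonneg hp₀ hp₀]
    · have hle : ∀ T U : Finset (Sym2 V), S ⊆ U → T ⊆ U →
          (#{f ∈ insert e E | (fromEdgeSet (U : Set (Sym2 V))).IsSeparated f} : ℝ) ≤
          #{f ∈ E | (fromEdgeSet ((S ∪ T : Finset (Sym2 V)) : Set (Sym2 V))).IsSeparated f} := by
        intro T U hS hT
        rw [filter_insert, if_neg fun h ↦ hsep (h.anti (fromEdgeSet_mono (by simpa using hS)))]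
        exact_mod_cast card_le_card (monotone_filter_right _ fun _ _ ↦
          IsSeparated.anti (fromEdgeSet_mono (by exact_mod_cast union_subset hS hT)))
      calc _ ≤ p * (p * E.bernoulliSum p (fun T ↦ (#{f ∈ E | (fromEdgeSet
              ((S ∪ T : Finset (Sym2 V)) : Set (Sym2 V))).IsSeparated f} : ℝ)) +
            (1 - p) * E.bernoulliSum p (fun T ↦ (#{f ∈ E | (fromEdgeSet
              ((S ∪ T : Finset (Sym2 V)) : Set (Sym2 V))).IsSeparated f} : ℝ))) := by
            gcongr
            · exact bernoulliSum_mono hp₀ hp₁ fun T _ ↦ hle T _ subset_union_left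
                ((subset_insert _ _).trans subset_union_right)
            · exact bernoulliSum_mono hp₀ hp₁ fun T _ ↦ hle T _ subset_union_left
                subset_union_right
        _ = p * E.bernoulliSum p (fun T ↦ (#{f ∈ E | (fromEdgeSet
              ((S ∪ T : Finset (Sym2 V)) : Set (Sym2 V))).IsSeparated f} : ℝ)) := by ring
        _ ≤ _ := ih S

/-! ### The number of components of a random subgraph -/

/-- The edges of `G` with exactly one end in `S`. -/
def edgeBoundary [Fintype V] [DecidableEq V] (G : SimpleGraph V) [DecidableRel G.Adj]
    (S : Finset V) : Finset (Sym2 V) :=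
  {e ∈ G.edgeFinset | ∃ u ∈ S, ∃ v ∉ S, e = s(u, v)}

/-- A set smaller than the minimum degree has a large boundary, since a vertex of `S` has fewer
than `#S` neighbours inside `S`. -/
lemma card_mul_le_card_edgeBoundary_add [Fintype V] [DecidableEq V] (G : SimpleGraph V)
    [DecidableRel G.Adj] {r : ℕ} (hr : ∀ v, r ≤ G.degree v) (S : Finset V) :
    #S * r ≤ #(G.edgeBoundary S) + #S * #S := by
  have h₁ : #(S.sigma fun u ↦ G.neighborFinset u \ S) ≤ #(G.edgeBoundary S) := by
    refine card_le_card_of_injOn (fun x ↦ s(x.1, x.2)) ?_ ?_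
    · rintro ⟨u, v⟩ h
      simp only [coe_sigma, Set.mem_sigma_iff, mem_coe, mem_sdiff, mem_neighborFinset] at h
      simp only [edgeBoundary, coe_filter, mem_edgeFinset, mem_edgeSet, Set.mem_ofPred_eq]
      exact ⟨h.2.1, u, h.1, v, h.2.2, rfl⟩
    · rintro ⟨u, v⟩ h ⟨u', v'⟩ h' heq
      simp only [coe_sigma, Set.mem_sigma_iff, mem_coe, mem_sdiff, mem_neighborFinset] at h h'
      obtain ⟨rfl, rfl⟩ | ⟨rfl, rfl⟩ := Sym2.eq_iff.1 heq
      · rfl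
      · exact absurd h.1 h'.2.2
  have h₂ : ∀ u ∈ S, r ≤ #(G.neighborFinset u \ S) + #S := fun u _ ↦
    calc r ≤ #(G.neighborFinset u) := by simpa using hr u
      _ ≤ _ := by rw [← Nat.sub_le_iff_le_add]; exact le_card_sdiff _ _
  calc #S * r = ∑ _u ∈ S, r := by simp
    _ ≤ ∑ u ∈ S, (#(G.neighborFinset u \ S) + #S) := sum_le_sum h₂
    _ = #(S.sigma fun u ↦ G.neighborFinset u \ S) + #S * #S := by
      simp [card_sigma, sum_add_distrib]
    _ ≤ _ := by gcongr

/-- Components with more than `r / 2` vertices number at most `2 * n / r`, and a smaller component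
is a vertex set whose boundary has no edge in `T`. -/
lemma card_connectedComponent_le [Fintype V] [DecidableEq V] (G : SimpleGraph V)
    [DecidableRel G.Adj] {r : ℕ} (hr : 0 < r) (T : Finset (Sym2 V)) :
    (Nat.card (fromEdgeSet (T : Set (Sym2 V))).ConnectedComponent : ℝ) ≤
      2 * Fintype.card V / r +
        ∑ S ∈ ({S : Finset V | S.Nonempty ∧ 2 * #S ≤ r} : Finset (Finset V)),
          if Disjoint T (G.edgeBoundary S) then 1 else 0 := by
  classical
  set H := fromEdgeSet (T : Set (Sym2 V))
  have := Fintype.ofFinite H.ConnectedComponent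
  let supp (c : H.ConnectedComponent) : Finset V := {v | H.connectedComponentMk v = c}
  have hsum : ∑ c, #(supp c) = Fintype.card V :=
    (card_eq_sum_card_fiberwise (f := H.connectedComponentMk) (s := univ) (t := univ)
      (by simp)).symm
  have hbig : (#{c | ¬ 2 * #(supp c) ≤ r} : ℝ) ≤ 2 * Fintype.card V / r := by
    rw [le_div_iff₀ (by exact_mod_cast hr)]
    norm_cast
    calc #{c | ¬ 2 * #(supp c) ≤ r} * r = ∑ c with ¬ 2 * #(supp c) ≤ r, r := by simp
      _ ≤ ∑ c with ¬ 2 * #(supp c) ≤ r, 2 * #(supp c) :=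
        sum_le_sum fun c hc ↦ (not_le.1 (mem_filter.1 hc).2).le
      _ ≤ ∑ c, 2 * #(supp c) := sum_le_univ_sum_of_nonneg fun _ ↦ Nat.zero_le _
      _ = 2 * Fintype.card V := by rw [← mul_sum, hsum]
  have hsmall : #{c | 2 * #(supp c) ≤ r} ≤
      #{S ∈ ({S : Finset V | S.Nonempty ∧ 2 * #S ≤ r} : Finset (Finset V)) |
        Disjoint T (G.edgeBoundary S)} := by
    have hne : ∀ c, (supp c).Nonempty := fun c ↦ by
      obtain ⟨v, hv⟩ := c.nonempty_supp
      exact ⟨v, by simpa [supp] using hv⟩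
    refine card_le_card_of_injOn supp ?_ ?_
    · intro c hc
      simp only [coe_filter, mem_filter, mem_univ, true_and, Set.mem_ofPred_eq] at hc ⊢
      refine ⟨⟨hne c, hc⟩, Finset.disjoint_left.2 fun e heT heB ↦ ?_⟩
      obtain ⟨-, u, hu, v, hv, rfl⟩ := mem_filter.1 heB
      have huv : H.Reachable u v := by
        have := not_isSeparated_of_mem (S := (T : Set (Sym2 V))) (mem_coe.2 heT)
        rwa [isSeparated_mk, not_not] at this
      simp only [supp, mem_filter, mem_univ, true_and] at hu hv
      exact hv ((ConnectedComponent.sound huv).symm.trans hu)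
    · intro c _ c' _ hcc
      obtain ⟨v, hv⟩ := hne c
      have hv' : v ∈ supp c' := hcc ▸ hv
      simp only [supp, mem_filter, mem_univ, true_and] at hv hv'
      exact hv.symm.trans hv'
  rw [sum_boole, Nat.card_eq_fintype_card, ← card_univ,
    ← card_filter_add_card_filter_not (s := univ) fun c ↦ 2 * #(supp c) ≤ r, Nat.cast_add, add_comm]
  exact add_le_add hbig (by exact_mod_cast hsmall)

/-- In a graph of minimum degree at least `r`, the union bound over all vertex sets of size at most
`r / 2` shows that a random subgraph of density `q` has `O(n / r)` components in expectation. -/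
lemma bernoulliSum_card_connectedComponent_le [Fintype V] [DecidableEq V] (G : SimpleGraph V)
    [DecidableRel G.Adj] {r : ℕ} (hr : 0 < r) (hdeg : ∀ v, r ≤ G.degree v) [Nonempty V] {q : ℝ}
    (hq₀ : 0 ≤ q) (hq₁ : q ≤ 1) (hq : 2 * Real.log (Fintype.card V) ≤ q * r) :
    G.edgeFinset.bernoulliSum q (fun T ↦
        (Nat.card (fromEdgeSet (T : Set (Sym2 V))).ConnectedComponent : ℝ)) ≤
      4 * Fintype.card V / r := by
  have hn : (0 : ℝ) < Fintype.card V := by exact_mod_cast Fintype.card_pos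
  have hr' : (0 : ℝ) < r := by exact_mod_cast hr
  set n : ℝ := (Fintype.card V : ℝ) with hn_def
  have hrn : (r : ℝ) ≤ n := by
    obtain ⟨v⟩ := ‹Nonempty V›
    rw [hn_def]
    exact_mod_cast (hdeg v).trans (G.degree_lt_card_verts v).le
  -- The boundary of a small set `S` has at least `#S * r / 2` edges, so it is avoided with
  -- probability at most `(1 / n) ^ #S`. The factor `1 ^ _` prepares the binomial theorem below.
  have hprob : ∀ S ∈ ({S : Finset V | S.Nonempty ∧ 2 * #S ≤ r} : Finset (Finset V)),
      (1 - q) ^ #(G.edgeFinset ∩ G.edgeBoundary S) ≤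
        (1 / n) ^ #S * 1 ^ (#(univ : Finset V) - #S) := by
    intro S hS
    obtain ⟨-, -, hS⟩ := mem_filter.1 hS
    have hB : (#S * r : ℝ) / 2 ≤ #(G.edgeBoundary S) := by
      have h₁ : (#S * r : ℝ) ≤ #(G.edgeBoundary S) + #S * #S := by
        exact_mod_cast card_mul_le_card_edgeBoundary_add G hdeg S
      have h₂ : (2 * #S : ℝ) ≤ r := by exact_mod_cast hS
      nlinarith [mul_le_mul_of_nonneg_left h₂ (Nat.cast_nonneg (α := ℝ) #S)]
    rw [inter_eq_right.2 (show G.edgeBoundary S ⊆ _ from filter_subset _ _), one_pow, mul_one]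
    calc (1 - q) ^ #(G.edgeBoundary S) ≤ Real.exp (-q) ^ #(G.edgeBoundary S) :=
          pow_le_pow_left₀ (sub_nonneg.2 hq₁) (Real.one_sub_le_exp_neg q) _
      _ = Real.exp (#(G.edgeBoundary S) * -q) := (Real.exp_nat_mul _ _).symm
      _ ≤ Real.exp (#S * -Real.log n) := by
        refine Real.exp_le_exp.2 ?_
        nlinarith [mul_le_mul_of_nonneg_left hB hq₀,
          mul_le_mul_of_nonneg_left hq (Nat.cast_nonneg (α := ℝ) #S)]
      _ = (1 / n) ^ #S := by
        rw [Real.exp_nat_mul, Real.exp_neg, Real.exp_log hn, one_div]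
  have hunion : ∑ S ∈ ({S : Finset V | S.Nonempty ∧ 2 * #S ≤ r} : Finset (Finset V)),
      (1 - q) ^ #(G.edgeFinset ∩ G.edgeBoundary S) ≤ 2 := by
    have h₁ : ∑ S ∈ (univ : Finset V).powerset, (1 / n) ^ #S * 1 ^ (#(univ : Finset V) - #S) ≤
        Real.exp 1 := by
      rw [sum_pow_mul_eq_add_pow, card_univ]
      calc (1 / n + 1) ^ Fintype.card V ≤ Real.exp (1 / n) ^ Fintype.card V :=
            pow_le_pow_left₀ (by positivity) (Real.add_one_le_exp _) _
        _ = Real.exp 1 := by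
          rw [← Real.exp_nat_mul, ← hn_def, mul_one_div_cancel hn.ne']
    -- The empty set contributes `1` to the sum over all subsets.
    rw [← add_sum_erase _ _ (empty_mem_powerset _)] at h₁
    have h₂ := Real.exp_one_lt_d9
    have h₃ : ∑ S ∈ ({S : Finset V | S.Nonempty ∧ 2 * #S ≤ r} : Finset (Finset V)),
        (1 - q) ^ #(G.edgeFinset ∩ G.edgeBoundary S) ≤
        ∑ S ∈ (univ : Finset V).powerset.erase ∅,
          (1 / n) ^ #S * 1 ^ (#(univ : Finset V) - #S) := by
      refine (sum_le_sum hprob).trans (sum_le_sum_of_subset_of_nonneg ?_ ?_)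
      · intro S hS
        simpa [nonempty_iff_ne_empty] using (mem_filter.1 hS).2.1.ne_empty
      · intros; positivity
    simp only [card_empty, pow_zero, one_pow, mul_one] at h₁ h₃
    linarith
  calc _ ≤ 2 * n / r + ∑ S ∈ ({S : Finset V | S.Nonempty ∧ 2 * #S ≤ r} : Finset (Finset V)),
        (1 - q) ^ #(G.edgeFinset ∩ G.edgeBoundary S) := by
        refine (bernoulliSum_mono hq₀ hq₁ fun T _ ↦ card_connectedComponent_le G hr T).trans_eq ?_
        simp only [bernoulliSum_add, bernoulliSum_const, bernoulliSum_sum, bernoulliSum_disjoint]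
        rfl
    _ ≤ 2 * n / r + 2 * (n / r) := by
        have : 1 ≤ n / r := (one_le_div hr').2 hrn
        linarith
    _ = 4 * n / r := by ring

end SimpleGraph

/-! ### Two rounds of sampling -/

open SimpleGraph in
theorem theorem4 :
    ∃ c : ℝ, 0 < c ∧ ∃ C : ℝ, 0 < C ∧
      ∀ (V : Type*) [Fintype V] (G : SimpleGraph V) [DecidableRel G.Adj] (r : ℕ)
        (p : unitInterval),
        G.IsAlmostRegular r →
        0 < p → p < 1 →
        c * Real.log (Fintype.card V) ≤ (p : ℝ) * r →
        G.expectedInterComponentEdges p ≤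
          C * (((Fintype.card V : ℝ) ^ 2 / (G.edgeSet.ncard : ℝ)) / (p : ℝ)) := by
  refine ⟨4, by norm_num, 8, by norm_num, fun V _ G _ r p hG hp₀ hp₁ hpr ↦ ?_⟩
  classical
  have hncard : ∀ T : Finset (Sym2 V), ((G.interComponentEdges (fromEdgeSet T)).ncard : ℝ) =
      #{e ∈ G.edgeFinset | (fromEdgeSet (T : Set (Sym2 V))).IsSeparated e} := fun T ↦ by
    rw [← Set.ncard_coe_finset]
    congr
    ext e
    simp [interComponentEdges, IsSeparated]
  have hm : G.edgeSet.ncard = #G.edgeFinset := by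
    rw [← Set.ncard_coe_finset, coe_edgeFinset]
  have hE : G.expectedInterComponentEdges p = G.edgeFinset.bernoulliSum p fun T ↦
      (#{e ∈ G.edgeFinset | (fromEdgeSet (T : Set (Sym2 V))).IsSeparated e} : ℝ) := by
    rw [expectedInterComponentEdges, ← coe_edgeFinset,
      ProbabilityTheory.integral_setBernoulli_coe_finset]
    exact bernoulliSum_congr fun T _ ↦ hncard T
  rw [hE, hm]
  obtain hm₀ | hm₀ := G.edgeFinset.eq_empty_or_nonempty
  · simp [hm₀]
  have hm₁ : (0 : ℝ) < #G.edgeFinset := by exact_mod_cast hm₀.card_pos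
  have hmr : #G.edgeFinset ≤ Fintype.card V * r := by
    have h₁ := G.sum_degrees_eq_twice_card_edges
    have h₂ : ∑ v, G.degree v ≤ ∑ _v : V, 2 * r := sum_le_sum fun v _ ↦ (hG v).2
    rw [sum_const, card_univ, smul_eq_mul] at h₂
    linarith
  have hnr : 0 < Fintype.card V * r := hm₀.card_pos.trans_le hmr
  have hn : 0 < Fintype.card V := Nat.pos_of_mul_pos_right hnr
  have hr : 0 < r := Nat.pos_of_mul_pos_left hnr
  have : Nonempty V := Fintype.card_pos_iff.1 hn
  have hn' : (0 : ℝ) < Fintype.card V := by exact_mod_cast hn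
  have hr' : (0 : ℝ) < r := by exact_mod_cast hr
  have hp₀' : (0 : ℝ) < p := hp₀
  have hp₁' : (p : ℝ) < 1 := hp₁
  -- Two rounds of densities `p / 2` and `q`, whose union has density `p`.
  obtain ⟨q, hq⟩ : ∃ q : ℝ, q = (p / 2) / (1 - p / 2) := ⟨_, rfl⟩
  have hden : (0 : ℝ) < 1 - p / 2 := by linarith
  have hpq : (p : ℝ) / 2 + q - p / 2 * q = p := by
    have : q * (1 - p / 2) = p / 2 := by rw [hq, div_mul_cancel₀ _ hden.ne']
    linarith
  have hq₁ : q ≤ 1 := by rw [hq, div_le_one hden]; linarith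
  have hpq' : (p : ℝ) / 2 ≤ q := by
    rw [hq, le_div_iff₀ hden]
    nlinarith
  have hq₀ : 0 < q := by linarith
  calc G.edgeFinset.bernoulliSum p (fun T ↦
        (#{e ∈ G.edgeFinset | (fromEdgeSet (T : Set (Sym2 V))).IsSeparated e} : ℝ))
      = G.edgeFinset.bernoulliSum (p / 2) (fun S ↦ G.edgeFinset.bernoulliSum q fun T ↦
        (#{e ∈ G.edgeFinset |
          (fromEdgeSet ((S ∪ T : Finset (Sym2 V)) : Set (Sym2 V))).IsSeparated e} : ℝ)) := by
        rw [← congrArg (fun x ↦ G.edgeFinset.bernoulliSum x _) hpq]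
        exact (bernoulliSum_bernoulliSum_union _).symm
    _ ≤ G.edgeFinset.bernoulliSum (p / 2) (fun S ↦
        q⁻¹ * (Nat.card (fromEdgeSet (S : Set (Sym2 V))).ConnectedComponent : ℝ)) := by
        refine bernoulliSum_mono (by linarith) (by linarith) fun S _ ↦ ?_
        rw [le_inv_mul_iff₀ hq₀]
        exact mul_bernoulliSum_card_isSeparated_le hq₀.le hq₁ _ S
    _ ≤ q⁻¹ * (4 * Fintype.card V / r) := by
        rw [bernoulliSum_const_mul]
        gcongr
        exact bernoulliSum_card_connectedComponent_le G hr (fun v ↦ (hG v).1) (by linarith)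
          (by linarith) (by linarith)
    _ ≤ (p / 2 : ℝ)⁻¹ * (4 * ((Fintype.card V : ℝ) ^ 2 / #G.edgeFinset)) := by
        have h : (Fintype.card V : ℝ) / r ≤ (Fintype.card V : ℝ) ^ 2 / #G.edgeFinset := by
          rw [div_le_div_iff₀ hr' hm₁, sq, mul_assoc]
          gcongr
          exact_mod_cast hmr
        rw [mul_div_assoc]
        gcongr
    _ = _ := by field_simp; norm_num
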